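/- Let $N\ge 1$, $1<p<2$, $T>0$, let $\Omega\subset\mathbb{R}^N$ be a bounded open set with Lipschitz boundary, $Q=(0,T)\times\Omega$, and let $0\le u_0\in L^1_{loc}(\Omega)$. *Notation.* For $k>0$, $T_k(r)=\max(\min(k,r),-k)$. $\mathcal P$ is the set of nondecreasing continuous functions $S:\mathbb{R}\to\mathbb{R}$ that are differentiable outside a finite set and whose derivative $S'$ has compact support. $W^{1,p}_k(\Omega)$ is the set of $v\in W^{1,p}(\Omega)$ whose trace on $\partial\Omega$ is the constant $k$. For measurable $u:Q\to\mathbb{R}$ such that all truncations $T_k(u)$ are weakly differentiable in $x$, $\nabla u$ denotes the a.e. unique measurable function $Q\to\mathbb{R}^N$ with $\nabla T_k(u)=\nabla u\,\chi_{\{|u|<k\}}$ a.e. in $Q$ for all $k>0$; and $\nabla S(T_h(u)-T_h(l))=S'(T_h(u)-T_h(l))\,\nabla T_h(u)$ for $S\in\mathcal P$, $h>0$, $l\in\mathbb{R}$. *Entropy large solutions.* A measurable function $u:Q\to\mathbb{R}$ is an entropy large solution of $$u_t-\Delta_p u=0 \text{ in } Q,\qquad u=u_0 \text{ on } \{0\}\times\Omega,\qquad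 u=+\infty \text{ on } (0,T)\times\partial\Omega$$ if $u\in C([0,T];L^1_{loc}(\Omega))$, $u(0)=u_0$ in $L^1_{loc}(\Omega)$, $T_k(u)\in L^p(0,T;W^{1,p}_k(\Omega))$ for all $k>0$, $|\nabla u|^{p-1}\in L^1_{loc}(Q)$, and $$\int_Q \eta\,|\nabla u|^{p-2}\nabla u\cdot\nabla S(T_h(u)-T_h(l))+\int_Q S(T_h(u)-T_h(l))\,|\nabla u|^{p-2}\nabla u\cdot\nabla\eta=\int_Q j_{S,h,l}(u)\,\eta_t$$ for all $S\in\mathcal P$, $h>0$, $l\in\mathbb{R}$ and $\eta\in\mathcal D(Q)=C_c^\infty(Q)$, where $j_{S,h,l}(r)=\int_l^r S(T_h(s)-T_h(l))\,ds$. *Proposition.* Every entropy large solution $u$ is a distributional solution of $u_t-\Delta_p u=0$ in $Q$; that is, $u\in L^1_{loc}(Q)$, $|\nabla u|^{p-2}\nabla u\in L^1_{loc}(Q;\mathbb{R}^N)$, and $$\int_Q|\nabla u|^{p-2}\nabla u\cdot\nabla\eta=\int_Q u\,\eta_t\qquad\text{for all }\eta\in\mathcal D(Q).$$ -/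

import Mathlib

open MeasureTheory Set Filter Topology
open scoped ContDiff NNReal ENNReal

noncomputable section

namespace LargeSolution

/-- The open set `Ω ⊆ ℝ^N` has Lipschitz boundary: near each boundary point, and after a choice of
a unit vector `e` as vertical direction, `Ω` is the strict epigraph of a Lipschitz function of the
component orthogonal to `e`. -/
def HasLipschitzBoundary {N : ℕ} (Ω : Set (EuclideanSpace ℝ (Fin N))) : Prop :=
  ∀ x ∈ frontier Ω, ∃ e : EuclideanSpace ℝ (Fin N), ‖e‖ = 1 ∧
    ∃ (K : ℝ≥0) (γ : (Submodule.span ℝ {e})ᗮ → ℝ), LipschitzWith K γ ∧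
      ∃ U ∈ 𝓝 x, ∀ y ∈ U,
        (y ∈ Ω ↔ γ ((Submodule.span ℝ {e})ᗮ.orthogonalProjectionOnto y) < inner ℝ e y)

/-- The cylinder `Q = (0,T) × Ω`. -/
def cylinder {N : ℕ} (T : ℝ) (Ω : Set (EuclideanSpace ℝ (Fin N))) :
    Set (ℝ × EuclideanSpace ℝ (Fin N)) :=
  Ioo 0 T ×ˢ Ω

/-- `φ ∈ 𝓓(U)`: smooth with compact support contained in `U`. -/
structure IsTest {F : Type*} [NormedAddCommGroup F] [NormedSpace ℝ F] (U : Set F)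
    (φ : F → ℝ) : Prop where
  smooth : ContDiff ℝ ∞ φ
  compact : HasCompactSupport φ
  support_subset : tsupport φ ⊆ U

/-- The time derivative `η_t`. -/
def timeDeriv {N : ℕ} (η : ℝ × EuclideanSpace ℝ (Fin N) → ℝ)
    (z : ℝ × EuclideanSpace ℝ (Fin N)) : ℝ :=
  deriv (fun s => η (s, z.2)) z.1

/-- The spatial gradient `∇η` of a differentiable function of `(t,x)`. -/
def spaceGrad {N : ℕ} (η : ℝ × EuclideanSpace ℝ (Fin N) → ℝ)
    (z : ℝ × EuclideanSpace ℝ (Fin N)) : EuclideanSpace ℝ (Fin N) :=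
  gradient (fun x => η (z.1, x)) z.2

/-- The truncation `T_k(r) = max (min k r) (-k)`. -/
def trunc (k r : ℝ) : ℝ := max (min k r) (-k)

/-- The class `𝓟`: nondecreasing continuous functions that are differentiable outside a finite set
and whose derivative has compact support (`deriv` is `0` at the exceptional points). -/
structure IsTruncature (S : ℝ → ℝ) : Prop where
  mono : Monotone S
  cont : Continuous S
  diff : ∃ F : Set ℝ, F.Finite ∧ ∀ r ∉ F, DifferentiableAt ℝ S r
  compact : HasCompactSupport (deriv S)

/-- `j_{S,h,l}(r) = ∫_l^r S(T_h(s) - T_h(l)) ds`. -/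
def jFun (S : ℝ → ℝ) (h l r : ℝ) : ℝ :=
  ∫ s in l..r, S (trunc h s - trunc h l)

/-- `g` is the weak gradient of `v` on `Ω`. -/
structure HasWeakGradient {N : ℕ} (Ω : Set (EuclideanSpace ℝ (Fin N)))
    (v : EuclideanSpace ℝ (Fin N) → ℝ)
    (g : EuclideanSpace ℝ (Fin N) → EuclideanSpace ℝ (Fin N)) : Prop where
  locInt : LocallyIntegrableOn v Ω
  locInt_grad : LocallyIntegrableOn g Ω
  byParts : ∀ φ : EuclideanSpace ℝ (Fin N) → ℝ, IsTest Ω φ →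
    ∫ x in Ω, v x • gradient φ x = -∫ x in Ω, φ x • g x

/-- `v ∈ W^{1,p}_k(Ω)` with weak gradient `g`: `v ∈ W^{1,p}(Ω)` and the trace of `v` on `∂Ω` is the
constant `k`. For a bounded Lipschitz domain the trace operator is the continuous extension of
`φ ↦ φ|_{∂Ω}` from functions smooth up to the boundary, so that the trace of `v` is `k` if and only
if `v` is the limit in `W^{1,p}(Ω)` of such functions whose boundary values converge to `k` in
`L^p(∂Ω, ℋ^{N-1})`. -/
structure MemSobolevTrace {N : ℕ} (p : ℝ) (Ω : Set (EuclideanSpace ℝ (Fin N))) (k : ℝ)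
    (v : EuclideanSpace ℝ (Fin N) → ℝ)
    (g : EuclideanSpace ℝ (Fin N) → EuclideanSpace ℝ (Fin N)) : Prop where
  memLp : MemLp v (ENNReal.ofReal p) (volume.restrict Ω)
  memLp_grad : MemLp g (ENNReal.ofReal p) (volume.restrict Ω)
  weak : HasWeakGradient Ω v g
  trace : ∃ φ : ℕ → EuclideanSpace ℝ (Fin N) → ℝ, (∀ n, ContDiff ℝ ∞ (φ n)) ∧
    Tendsto (fun n => eLpNorm (fun x => φ n x - v x) (ENNReal.ofReal p) (volume.restrict Ω))
      atTop (𝓝 0) ∧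
    Tendsto (fun n => eLpNorm (fun x => gradient (φ n) x - g x) (ENNReal.ofReal p)
      (volume.restrict Ω)) atTop (𝓝 0) ∧
    Tendsto (fun n => eLpNorm (fun x => φ n x - k) (ENNReal.ofReal p)
      ((Measure.hausdorffMeasure ((N : ℝ) - 1)).restrict (frontier Ω))) atTop (𝓝 0)

/-- `v ∈ L^p(0,T; W^{1,p}_k(Ω))`: for a.e. `t` the slice `v(t)` is in `W^{1,p}_k(Ω)`, and `v` and its
spatial weak gradient are (jointly measurable and) in `L^p(Q)`. -/
def MemLpSobolevTrace {N : ℕ} (p T : ℝ) (Ω : Set (EuclideanSpace ℝ (Fin N))) (k : ℝ)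
    (v : ℝ × EuclideanSpace ℝ (Fin N) → ℝ) : Prop :=
  ∃ g : ℝ × EuclideanSpace ℝ (Fin N) → EuclideanSpace ℝ (Fin N),
    MemLp v (ENNReal.ofReal p) (volume.restrict (cylinder T Ω)) ∧
    MemLp g (ENNReal.ofReal p) (volume.restrict (cylinder T Ω)) ∧
    ∀ᵐ t ∂(volume.restrict (Ioo 0 T)),
      MemSobolevTrace p Ω k (fun x => v (t, x)) (fun x => g (t, x))

/-- `G` is the generalized (spatial) gradient `∇u` of `u` on `Q`: the a.e. unique measurable
function with `∇ T_k(u) = G χ_{|u|<k}` for all `k > 0`. -/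
structure IsGenGradient {N : ℕ} (T : ℝ) (Ω : Set (EuclideanSpace ℝ (Fin N)))
    (u : ℝ × EuclideanSpace ℝ (Fin N) → ℝ)
    (G : ℝ × EuclideanSpace ℝ (Fin N) → EuclideanSpace ℝ (Fin N)) : Prop where
  meas : AEMeasurable G (volume.restrict (cylinder T Ω))
  grad : ∀ k : ℝ, 0 < k → ∀ᵐ t ∂(volume.restrict (Ioo 0 T)),
    HasWeakGradient Ω (fun x => trunc k (u (t, x)))
      (fun x => {z | |u z| < k}.indicator G (t, x))

/-- The flux `|ξ|^{p-2} ξ` (equal to `0` at `ξ = 0`). -/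
def flux {N : ℕ} (p : ℝ) (ξ : EuclideanSpace ℝ (Fin N)) : EuclideanSpace ℝ (Fin N) :=
  ‖ξ‖ ^ (p - 2) • ξ

/-- `∇ S(T_h(u) - T_h(l)) = S'(T_h(u) - T_h(l)) ∇T_h(u)`, where `∇T_h(u) = ∇u χ_{|u|<h}`. The
exceptional points of `S` are immaterial, since `∇T_h(u) = 0` a.e. on level sets of `T_h(u)`. -/
def gradTruncature {N : ℕ} (S : ℝ → ℝ) (h l : ℝ)
    (u : ℝ × EuclideanSpace ℝ (Fin N) → ℝ)
    (G : ℝ × EuclideanSpace ℝ (Fin N) → EuclideanSpace ℝ (Fin N))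
    (z : ℝ × EuclideanSpace ℝ (Fin N)) : EuclideanSpace ℝ (Fin N) :=
  deriv S (trunc h (u z) - trunc h l) • {z | |u z| < h}.indicator G z

/-- `u ∈ C([0,T]; L^1_loc(Ω))` and `u(0) = u₀` in `L^1_loc(Ω)`: some representative `U` of `u` is
continuous on `[0,T]` with values in `L^1(K)`, for each compact `K ⊆ Ω`, and starts at `u₀`. -/
def IsContinuousL1Loc {N : ℕ} (T : ℝ) (Ω : Set (EuclideanSpace ℝ (Fin N)))
    (u₀ : EuclideanSpace ℝ (Fin N) → ℝ) (u : ℝ × EuclideanSpace ℝ (Fin N) → ℝ) : Prop :=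
  ∃ U : ℝ → EuclideanSpace ℝ (Fin N) → ℝ,
    (∀ᵐ t ∂(volume.restrict (Ioo 0 T)), ∀ᵐ x ∂(volume.restrict Ω), u (t, x) = U t x) ∧
    (∀ K : Set (EuclideanSpace ℝ (Fin N)), IsCompact K → K ⊆ Ω → ∀ t ∈ Icc 0 T,
      IntegrableOn (U t) K ∧
      Tendsto (fun s => eLpNorm (fun x => U s x - U t x) 1 (volume.restrict K))
        (𝓝[Icc 0 T] t) (𝓝 0)) ∧
    (∀ᵐ x ∂(volume.restrict Ω), U 0 x = u₀ x)

/-- Entropy large solutions of `u_t - Δ_p u = 0` in `Q`, `u = u₀` at `t = 0`, `u = +∞` on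
`(0,T) × ∂Ω`. -/
structure IsEntropyLargeSolution {N : ℕ} (p T : ℝ) (Ω : Set (EuclideanSpace ℝ (Fin N)))
    (u₀ : EuclideanSpace ℝ (Fin N) → ℝ) (u : ℝ × EuclideanSpace ℝ (Fin N) → ℝ) : Prop where
  meas : AEMeasurable u (volume.restrict (cylinder T Ω))
  cont : IsContinuousL1Loc T Ω u₀ u
  trunc_mem : ∀ k : ℝ, 0 < k → MemLpSobolevTrace p T Ω k (fun z => trunc k (u z))
  entropy : ∃ G : ℝ × EuclideanSpace ℝ (Fin N) → EuclideanSpace ℝ (Fin N),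
    IsGenGradient T Ω u G ∧
    LocallyIntegrableOn (fun z => ‖G z‖ ^ (p - 1)) (cylinder T Ω) ∧
    ∀ (S : ℝ → ℝ) (h l : ℝ) (η : ℝ × EuclideanSpace ℝ (Fin N) → ℝ),
      IsTruncature S → 0 < h → IsTest (cylinder T Ω) η →
      (∫ z in cylinder T Ω, η z * inner ℝ (flux p (G z)) (gradTruncature S h l u G z)) +
        (∫ z in cylinder T Ω,
          S (trunc h (u z) - trunc h l) * inner ℝ (flux p (G z)) (spaceGrad η z)) =
        ∫ z in cylinder T Ω, jFun S h l (u z) * timeDeriv η z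

/-- Distributional solutions of `u_t - Δ_p u = 0` in `Q`: `u` and `|∇u|^{p-2}∇u` are in `L^1_loc(Q)`,
where `∇u` is the generalized gradient, and `u_t = div(|∇u|^{p-2}∇u)` in `𝓓'(Q)`. -/
def IsDistributionalSolution {N : ℕ} (p T : ℝ) (Ω : Set (EuclideanSpace ℝ (Fin N)))
    (u : ℝ × EuclideanSpace ℝ (Fin N) → ℝ) : Prop :=
  LocallyIntegrableOn u (cylinder T Ω) ∧
  (∃ G, IsGenGradient T Ω u G) ∧
  ∀ G, IsGenGradient T Ω u G →
    LocallyIntegrableOn (fun z => flux p (G z)) (cylinder T Ω) ∧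
    ∀ η : ℝ × EuclideanSpace ℝ (Fin N) → ℝ, IsTest (cylinder T Ω) η →
      ∫ z in cylinder T Ω, inner ℝ (flux p (G z)) (spaceGrad η z) =
        ∫ z in cylinder T Ω, u z * timeDeriv η z

end LargeSolution

end

namespace LargeSolution

/-! Constants are admissible in the entropy identity. With `S = 1` and `l = 0` the term carrying
`deriv S` vanishes and `jFun S h l r = r`, so the identity becomes the distributional equation. What
remains is integrability and independence of the chosen gradient: `u` is in `L^1_loc(Q)` because an
`L^1(K)`-continuous curve on the compact `[0,T]` is bounded; the flux has norm `‖∇u‖ ^ (p - 1)`,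
locally integrable by assumption; and `IsGenGradient.ae_eq` carries the identity from the gradient
it is stated for to any other. -/

/-- Weak gradients on an open set are a.e. unique. -/
theorem HasWeakGradient.ae_eq {N : ℕ} {Ω : Set (EuclideanSpace ℝ (Fin N))} (hΩ : IsOpen Ω)
    {v : EuclideanSpace ℝ (Fin N) → ℝ}
    {g g' : EuclideanSpace ℝ (Fin N) → EuclideanSpace ℝ (Fin N)}
    (hg : HasWeakGradient Ω v g) (hg' : HasWeakGradient Ω v g') :
    ∀ᵐ x ∂(volume.restrict Ω), g x = g' x := by
  have key : ∀ᵐ x ∂volume, x ∈ Ω → (g - g') x = 0 := by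
    -- Fundamental lemma of the calculus of variations, applied to the difference.
    refine hΩ.ae_eq_zero_of_integral_contDiff_smul_eq_zero (hg.locInt_grad.sub hg'.locInt_grad) ?_
    intro φ hφ hφc hφs
    have hint : ∀ f : EuclideanSpace ℝ (Fin N) → EuclideanSpace ℝ (Fin N),
        LocallyIntegrableOn f Ω → Integrable (fun x => φ x • f x) volume := by
      intro f hf
      have hK : IntegrableOn f (tsupport φ) :=
        hf.integrableOn_compact_subset hφs hφc
      have h1 : IntegrableOn (fun x => φ x • f x) (tsupport φ) :=
        hK.continuousOn_smul hφ.continuous.continuousOn hφc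
      refine (integrableOn_iff_integrable_of_support_subset ?_).1 h1
      exact (Function.support_smul_subset_left φ f).trans (subset_tsupport φ)
    have hset : ∀ f : EuclideanSpace ℝ (Fin N) → EuclideanSpace ℝ (Fin N),
        ∫ x in Ω, φ x • f x = ∫ x, φ x • f x := by
      intro f
      refine setIntegral_eq_integral_of_forall_compl_eq_zero fun x hx => ?_
      rw [image_eq_zero_of_notMem_tsupport fun h => hx (hφs h), zero_smul]
    have e1 := hg.byParts φ ⟨hφ, hφc, hφs⟩
    have e2 := hg'.byParts φ ⟨hφ, hφc, hφs⟩
    rw [hset] at e1 e2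
    simp only [Pi.sub_apply, smul_sub]
    rw [integral_sub (hint g hg.locInt_grad) (hint g' hg'.locInt_grad), sub_eq_zero]
    exact neg_injective (e1.symm.trans e2)
  filter_upwards [ae_restrict_of_ae key, ae_restrict_mem hΩ.measurableSet] with x hx hxΩ
  exact sub_eq_zero.1 (hx hxΩ)

theorem volume_restrict_cylinder {N : ℕ} (T : ℝ) (Ω : Set (EuclideanSpace ℝ (Fin N))) :
    (volume : Measure (ℝ × EuclideanSpace ℝ (Fin N))).restrict (cylinder T Ω) =
      (volume.restrict (Ioo 0 T)).prod (volume.restrict Ω) := by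
  rw [cylinder, Measure.volume_eq_prod, Measure.prod_restrict]

/-- The generalized gradient is a.e. unique. -/
theorem IsGenGradient.ae_eq {N : ℕ} {T : ℝ} {Ω : Set (EuclideanSpace ℝ (Fin N))} (hΩ : IsOpen Ω)
    {u : ℝ × EuclideanSpace ℝ (Fin N) → ℝ}
    {G G' : ℝ × EuclideanSpace ℝ (Fin N) → EuclideanSpace ℝ (Fin N)}
    (hG : IsGenGradient T Ω u G) (hG' : IsGenGradient T Ω u G') :
    G =ᵐ[volume.restrict (cylinder T Ω)] G' := by
  have hslice : ∀ᵐ t ∂(volume.restrict (Ioo 0 T)), ∀ᵐ x ∂(volume.restrict Ω),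
      G (t, x) = G' (t, x) := by
    -- Countably many levels `n + 1 > 0` suffice, so one null set of times serves for all of them.
    have hk : ∀ᵐ t ∂(volume.restrict (Ioo 0 T)), ∀ n : ℕ, ∀ᵐ x ∂(volume.restrict Ω),
        {z | |u z| < (n : ℝ) + 1}.indicator G (t, x) =
          {z | |u z| < (n : ℝ) + 1}.indicator G' (t, x) := by
      refine ae_all_iff.2 fun n => ?_
      filter_upwards [hG.grad (n + 1) (by positivity), hG'.grad (n + 1) (by positivity)]
        with t h h'
      exact h.ae_eq hΩ h'
    filter_upwards [hk] with t ht
    filter_upwards [ae_all_iff.2 ht] with x hx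
    obtain ⟨n, hn⟩ := exists_nat_gt |u (t, x)|
    have hmem : (t, x) ∈ {z | |u z| < (n : ℝ) + 1} := hn.trans (lt_add_one _)
    simpa only [indicator_of_mem hmem] using hx n
  have hm := hG.meas
  have hm' := hG'.meas
  rw [volume_restrict_cylinder] at hm hm' ⊢
  -- Slicewise equality gives equality a.e. for the product measure only on a measurable set, hence
  -- the measurable representatives.
  have hmk : hm.mk G =ᵐ[(volume.restrict (Ioo 0 T)).prod (volume.restrict Ω)] hm'.mk G' := by
    refine (Measure.ae_prod_iff_ae_ae
      (measurableSet_eq_fun hm.measurable_mk hm'.measurable_mk)).2 ?_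
    filter_upwards [hslice, Measure.ae_ae_of_ae_prod hm.ae_eq_mk,
      Measure.ae_ae_of_ae_prod hm'.ae_eq_mk] with t h1 h2 h3
    filter_upwards [h1, h2, h3] with x e1 e2 e3
    rw [← e2, ← e3, e1]
  exact hm.ae_eq_mk.trans (hmk.trans hm'.ae_eq_mk.symm)

/-- A curve that is continuous on `[0,T]` for the `L^1` seminorm is bounded. -/
theorem exists_eLpNorm_one_le {α : Type*} [MeasurableSpace α] {μ : Measure α} {T : ℝ}
    {U : ℝ → α → ℝ} (hU : ∀ t ∈ Icc 0 T, Integrable (U t) μ ∧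
      Tendsto (fun s => eLpNorm (fun x => U s x - U t x) 1 μ) (𝓝[Icc 0 T] t) (𝓝 0)) :
    ∃ C : ℝ≥0∞, C < ⊤ ∧ ∀ t ∈ Icc 0 T, eLpNorm (U t) 1 μ ≤ C := by
  -- Boundedness on a subset of `[0,T]` passes to smaller sets and finite unions, so a local bound
  -- is enough.
  refine isCompact_Icc.induction_on (p := fun s => ∃ C : ℝ≥0∞, C < ⊤ ∧
    ∀ t ∈ s, eLpNorm (U t) 1 μ ≤ C) ⟨0, by simp⟩ ?_ ?_ ?_
  · rintro s s' hs ⟨C, hC, h⟩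
    exact ⟨C, hC, fun t ht => h t (hs ht)⟩
  · rintro s s' ⟨C, hC, h⟩ ⟨C', hC', h'⟩
    refine ⟨max C C', max_lt hC hC', ?_⟩
    rintro t (ht | ht)
    · exact (h t ht).trans (le_max_left _ _)
    · exact (h' t ht).trans (le_max_right _ _)
  · intro t ht
    refine ⟨{s | s ∈ Icc 0 T ∧ eLpNorm (fun x => U s x - U t x) 1 μ < 1}, ?_,
      1 + eLpNorm (U t) 1 μ, ?_, ?_⟩
    · exact inter_mem self_mem_nhdsWithin ((hU t ht).2 (gt_mem_nhds one_pos))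
    · exact ENNReal.add_lt_top.2
        ⟨ENNReal.one_lt_top, (memLp_one_iff_integrable.2 (hU t ht).1).eLpNorm_lt_top⟩
    · rintro s ⟨hs, hs1⟩
      have hadd : U s = (fun x => U s x - U t x) + U t := by ext x; simp
      calc eLpNorm (U s) 1 μ = eLpNorm ((fun x => U s x - U t x) + U t) 1 μ := by rw [← hadd]
        _ ≤ eLpNorm (fun x => U s x - U t x) 1 μ + eLpNorm (U t) 1 μ :=
          eLpNorm_add_le ((hU s hs).1.sub (hU t ht).1).aestronglyMeasurable
            (hU t ht).1.aestronglyMeasurable le_rfl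
        _ ≤ 1 + eLpNorm (U t) 1 μ := by gcongr

/-- Functions in `C([0,T]; L^1_loc(Ω))` are in `L^1_loc(Q)`. -/
theorem IsContinuousL1Loc.locallyIntegrableOn {N : ℕ} {T : ℝ}
    {Ω : Set (EuclideanSpace ℝ (Fin N))} (hΩ : IsOpen Ω)
    {u₀ : EuclideanSpace ℝ (Fin N) → ℝ} {u : ℝ × EuclideanSpace ℝ (Fin N) → ℝ}
    (hu : AEMeasurable u (volume.restrict (cylinder T Ω))) (hc : IsContinuousL1Loc T Ω u₀ u) :
    LocallyIntegrableOn u (cylinder T Ω) := by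
  obtain ⟨U, hUu, hU, -⟩ := hc
  rintro ⟨t, x⟩ ⟨-, hx⟩
  obtain ⟨K, hK, hxK, hKΩ⟩ := exists_compact_subset hΩ hx
  -- Only space needs localizing: the bound on `U` is uniform up to both ends of `[0,T]`.
  refine ⟨cylinder T K, ?_, ?_⟩
  · have hnhds : (univ : Set ℝ) ×ˢ K ∈ 𝓝 (t, x) :=
      prod_mem_nhds univ_mem (mem_interior_iff_mem_nhds.1 hxK)
    filter_upwards [self_mem_nhdsWithin, mem_nhdsWithin_of_mem_nhds hnhds] with z hz hz'
    exact ⟨hz.1, hz'.2⟩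
  · obtain ⟨C, hC, hUC⟩ := exists_eLpNorm_one_le (hU K hK hKΩ)
    have hmeas : AEMeasurable u (volume.restrict (cylinder T K)) :=
      hu.mono_set (prod_mono_right hKΩ)
    refine ⟨hmeas.aestronglyMeasurable, ?_⟩
    rw [volume_restrict_cylinder] at hmeas ⊢
    rw [HasFiniteIntegral, lintegral_prod _ hmeas.enorm]
    calc ∫⁻ s in Ioo 0 T, ∫⁻ y in K, ‖u (s, y)‖ₑ ≤ ∫⁻ _ in Ioo 0 T, C := by
          refine lintegral_mono_ae ?_
          filter_upwards [hUu, ae_restrict_mem measurableSet_Ioo] with s hs hsT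
          refine le_trans (le_of_eq ?_) (hUC s (Ioo_subset_Icc_self hsT))
          rw [eLpNorm_one_eq_lintegral_enorm]
          refine lintegral_congr_ae ?_
          filter_upwards [ae_restrict_of_ae_restrict_of_subset hKΩ hs] with y hy
          rw [hy]
      _ < ⊤ := by
          rw [setLIntegral_const]
          exact ENNReal.mul_lt_top hC measure_Ioo_lt_top

theorem norm_flux {N : ℕ} {p : ℝ} (hp : 1 < p) (ξ : EuclideanSpace ℝ (Fin N)) :
    ‖flux p ξ‖ = ‖ξ‖ ^ (p - 1) := by
  -- At `ξ = 0` the vector factor kills the flux whatever `0 ^ (p - 2)` is, and `0 ^ (p - 1) = 0`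
  -- since `p ≠ 1`.
  rcases eq_or_ne ξ 0 with rfl | hξ
  · simp [flux, Real.zero_rpow (sub_ne_zero.2 hp.ne')]
  · have hpos : 0 < ‖ξ‖ := norm_pos_iff.2 hξ
    rw [flux, norm_smul, Real.norm_of_nonneg (Real.rpow_nonneg hpos.le _),
      ← Real.rpow_add_one hpos.ne']
    congr 1
    ring

theorem measurable_flux {N : ℕ} (p : ℝ) :
    Measurable (flux p : EuclideanSpace ℝ (Fin N) → EuclideanSpace ℝ (Fin N)) :=
  (measurable_norm.pow_const _).smul measurable_id

theorem locallyIntegrableOn_flux {N : ℕ} {p : ℝ} (hp : 1 < p)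
    {Q : Set (ℝ × EuclideanSpace ℝ (Fin N))}
    {G : ℝ × EuclideanSpace ℝ (Fin N) → EuclideanSpace ℝ (Fin N)}
    (hG : AEMeasurable G (volume.restrict Q))
    (hGi : LocallyIntegrableOn (fun z => ‖G z‖ ^ (p - 1)) Q) :
    LocallyIntegrableOn (fun z => flux p (G z)) Q := by
  intro z hz
  obtain ⟨s, hs, hsi⟩ := hGi z hz
  -- `G` is known to be measurable only on `Q`.
  refine ⟨s ∩ Q, inter_mem hs self_mem_nhdsWithin, ?_⟩
  refine (hsi.mono_set inter_subset_left).mono'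
    ((measurable_flux p).comp_aemeasurable
      (hG.mono_set inter_subset_right)).aestronglyMeasurable
    (ae_of_all _ fun y => (norm_flux hp (G y)).le)

theorem isTruncature_const (c : ℝ) : IsTruncature fun _ => c where
  mono := monotone_const
  cont := continuous_const
  diff := ⟨∅, finite_empty, fun _ _ => differentiableAt_const c⟩
  compact := by
    rw [deriv_const']
    exact HasCompactSupport.zero

end LargeSolution

theorem proposition3p2 {N : ℕ} (hN : 1 ≤ N) (p : ℝ) (hp1 : 1 < p) (hp2 : p < 2)
    (T : ℝ) (hT : 0 < T) (Ω : Set (EuclideanSpace ℝ (Fin N))) (hΩo : IsOpen Ω)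
    (hΩb : Bornology.IsBounded Ω) (hΩl : LargeSolution.HasLipschitzBoundary Ω)
    (u₀ : EuclideanSpace ℝ (Fin N) → ℝ) (hu₀ : LocallyIntegrableOn u₀ Ω)
    (hu₀_nonneg : ∀ᵐ x ∂(volume.restrict Ω), 0 ≤ u₀ x)
    (u : ℝ × EuclideanSpace ℝ (Fin N) → ℝ)
    (hu : LargeSolution.IsEntropyLargeSolution p T Ω u₀ u) :
    LargeSolution.IsDistributionalSolution p T Ω u := by
  obtain ⟨G₀, hG₀, hG₀i, hent⟩ := hu.entropy
  refine ⟨hu.cont.locallyIntegrableOn hΩo hu.meas, ⟨G₀, hG₀⟩, fun G hG => ?_⟩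
  have hae := hG₀.ae_eq hΩo hG
  refine ⟨(LargeSolution.locallyIntegrableOn_flux hp1 hG₀.meas hG₀i).congr ?_, fun η hη => ?_⟩
  · filter_upwards [hae] with z hz
    rw [hz]
  · -- The constant `S = 1` belongs to the class of truncatures, and `jFun 1 h 0 r = r`.
    have h1 := hent (fun _ => 1) 1 0 η (LargeSolution.isTruncature_const 1) one_pos hη
    simp only [LargeSolution.gradTruncature, LargeSolution.jFun, deriv_const', zero_smul,
      inner_zero_right, mul_zero, integral_zero, zero_add, one_mul,
      intervalIntegral.integral_const, sub_zero, smul_eq_mul, mul_one] at h1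
    rw [← h1]
    -- The identity holds for `G₀`; a.e. equality transfers it to `G`.
    refine integral_congr_ae ?_
    filter_upwards [hae] with z hz
    rw [hz]
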